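/- Let $-\infty<a<b<\infty$ and let $p,q,r:(a,b)\to\mathbb{R}$ satisfy $p,r>0$ a.e. and $r,\,1/p,\,q\in L^1((a,b);dx)$. Put $y^{[1]}=py'$ and $\tau y=\frac1r\big(-(y^{[1]})'+qy\big)$. In $L^2((a,b);r\,dx)$, whose inner product $(\cdot,\cdot)$ is linear in the second argument, let $H_{\max}g=\tau g$ with $$\operatorname{dom}(H_{\max})=\{g\in L^2((a,b);r\,dx)\mid g,g^{[1]}\in AC([a,b]),\ \tau g\in L^2((a,b);r\,dx)\},$$ let $H_{\min}$ be its restriction by $g(a)=g^{[1]}(a)=g(b)=g^{[1]}(b)=0$, and let $H_{0,0}$ (the Dirichlet operator) be its restriction by $g(a)=g(b)=0$. For $F=(F_{j,k})\in SL_2(\mathbb{R})$ and $\phi\in[0,2\pi)$ let $H_{F,\phi}$ be the restriction of $H_{\max}$ by $$\begin{pmatrix}g(b)\\ g^{[1]}(b)\end{pmatrix}=e^{i\phi}F\begin{pmatrix}g(a)\\ g^{[1]}(a)\end{pmatrix}.$$ The maximal common part of operators $A_1,A_2$ is the restriction of $A_1$ to $\{f\in\operatorname{dom}(A_1)\cap\operatorname{dom}(A_2)\mid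 A_1f=A_2f\}$. **Theorem.** For each $z\in\rho(H_{0,0})$ there are unique solutions $u_1(z,\cdot),u_2(z,\cdot)$ of $\tau u=zu$ on $[a,b]$ with $u,u^{[1]}\in AC([a,b])$ and $$u_1(z,a)=0,\quad u_1(z,b)=1,\qquad u_2(z,a)=1,\quad u_2(z,b)=0,$$ and they form a basis of $\ker(H_{\max}-z)$. Moreover: (i) If $F_{1,2}\neq0$, then the maximal common part of $H_{F,\phi}$ and $H_{0,0}$ is $H_{\min}$, and for every $z\in\rho(H_{F,\phi})\cap\rho(H_{0,0})$ the matrix $$Q_{F,\phi}(z)=\begin{pmatrix}\frac{F_{2,2}}{F_{1,2}}-u_1^{[1]}(z,b)&\frac{-1}{e^{-i\phi}F_{1,2}}-u_2^{[1]}(z,b)\\[1mm] \frac{-1}{e^{i\phi}F_{1,2}}+u_1^{[1]}(z,a)&\frac{F_{1,1}}{F_{1,2}}+u_2^{[1]}(z,a)\end{pmatrix}$$ is invertible and $$(H_{F,\phi}-z)^{-1}=(H_{0,0}-z)^{-1}-\sum_{j,k=1}^2\big(Q_{F,\phi}(z)^{-1}\big)_{j,k}\,(u_k(\overline z,\cdot),\,\cdot\,)\,u_j(z,\cdot).$$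 (ii) If $F_{1,2}=0$, then the maximal common part of $H_{F,\phi}$ and $H_{0,0}$ is the restriction of $H_{\max}$ to $$\{g\in\operatorname{dom}(H_{\max})\mid g(a)=g(b)=0,\ g^{[1]}(b)=e^{i\phi}F_{2,2}\,g^{[1]}(a)\},$$ and for every $z\in\rho(H_{F,\phi})\cap\rho(H_{0,0})$ the number $$q_{F,\phi}(z)=F_{2,1}F_{2,2}+F_{2,2}^2u_2^{[1]}(z,a)+e^{i\phi}F_{2,2}u_1^{[1]}(z,a)-e^{-i\phi}F_{2,2}u_2^{[1]}(z,b)-u_1^{[1]}(z,b)$$ is nonzero and $$(H_{F,\phi}-z)^{-1}=(H_{0,0}-z)^{-1}-q_{F,\phi}(z)^{-1}\,(u_{F,\phi}(\overline z,\cdot),\,\cdot\,)\,u_{F,\phi}(z,\cdot),$$ where $u_{F,\phi}(z,\cdot)=e^{-i\phi}F_{2,2}\,u_2(z,\cdot)+u_1(z,\cdot)$. -/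

import Mathlib

open MeasureTheory

/-- The data of a regular three-coefficient Sturm--Liouville expression
`τ = (1/r) [-(d/dx) p (d/dx) + q]` on a finite interval `(a, b)`. -/
structure SturmLiouville where
  (a b : ℝ)
  (p q r : ℝ → ℝ)
  a_lt_b : a < b
  r_pos : ∀ᵐ x ∂(volume.restrict (Set.Ioo a b)), 0 < r x
  r_int : IntegrableOn r (Set.Ioo a b)
  p_pos : ∀ᵐ x ∂(volume.restrict (Set.Ioo a b)), 0 < p x
  p_int : IntegrableOn (fun x => 1 / p x) (Set.Ioo a b)
  q_int : IntegrableOn q (Set.Ioo a b)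

namespace SturmLiouville

/-! ### Generalities on unbounded operators in a complex Hilbert space -/

section Operators

variable {E : Type*} [NormedAddCommGroup E] [InnerProductSpace ℂ E]

/-- `R` is a bounded, everywhere defined, two-sided inverse of `T - z`. -/
def IsResolventAt (T : E →ₗ.[ℂ] E) (z : ℂ) (R : E →L[ℂ] E) : Prop :=
  (∀ f : E, ∃ g : T.domain, (g : E) = R f ∧ T g - z • (g : E) = f) ∧
    ∀ g : T.domain, R (T g - z • (g : E)) = g

/-- The resolvent set `ρ(T)`. -/
def resolventSet (T : E →ₗ.[ℂ] E) : Set ℂ := {z | ∃ R, IsResolventAt T z R}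

open scoped Classical in
/-- The resolvent `(T - z)⁻¹` for `z ∈ ρ(T)` (and `0` for other `z`). -/
noncomputable def resolvent (T : E →ₗ.[ℂ] E) (z : ℂ) : E →L[ℂ] E :=
  if h : ∃ R, IsResolventAt T z R then h.choose else 0

theorem isResolventAt_resolvent {T : E →ₗ.[ℂ] E} {z : ℂ} (hz : z ∈ resolventSet T) :
    IsResolventAt T z (resolvent T z) := by
  have h : ∃ R, IsResolventAt T z R := hz
  rw [resolvent, dif_pos h]
  exact h.choose_spec

theorem IsResolventAt.unique {T : E →ₗ.[ℂ] E} {z : ℂ} {R R' : E →L[ℂ] E}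
    (h : IsResolventAt T z R) (h' : IsResolventAt T z R') : R = R' := by
  ext f
  obtain ⟨g, hg, hf⟩ := h.1 f
  rw [← hg, ← hf, h'.2 g]

/-- The maximal common part of two operators: the restriction of either one to
`{f ∈ dom A₁ ∩ dom A₂ | A₁ f = A₂ f}`. -/
def maximalCommonPart (A₁ A₂ : E →ₗ.[ℂ] E) : E →ₗ.[ℂ] E := A₁ ⊓ A₂

/-- `ker (T - z)`, as a subspace of the Hilbert space. -/
def kernelAt (T : E →ₗ.[ℂ] E) (z : ℂ) : Submodule ℂ E where
  carrier := {f | ∃ h : f ∈ T.domain, T ⟨f, h⟩ = z • f}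
  zero_mem' := ⟨T.domain.zero_mem, by
    rw [smul_zero]; exact T.map_zero⟩
  add_mem' := by
    rintro f g ⟨hf, ef⟩ ⟨hg, eg⟩
    refine ⟨T.domain.add_mem hf hg, ?_⟩
    rw [smul_add, ← ef, ← eg, ← T.map_add]; rfl
  smul_mem' := by
    rintro c f ⟨hf, ef⟩
    refine ⟨T.domain.smul_mem c hf, ?_⟩
    rw [smul_comm, ← ef, ← T.map_smul]; rfl

end Operators

/-! ### The Hilbert space, quasi-derivatives and the differential expression -/

variable (D : SturmLiouville)

/-- The measure `r dx` on `(a, b)`. -/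
noncomputable def μ : Measure ℝ :=
  (volume.restrict (Set.Ioo D.a D.b)).withDensity (fun x => ENNReal.ofReal (D.r x))

/-- The Hilbert space `L²((a,b); r dx)`; its inner product is linear in the second entry. -/
abbrev H : Type := Lp ℂ 2 D.μ

/-- `y` and its first quasi-derivative `v = y^{[1]} = p y'` belong to `AC([a,b])`. -/
structure IsQuasiPair (y v : ℝ → ℂ) : Prop where
  ac : AbsolutelyContinuousOnInterval y D.a D.b
  ac_quasi : AbsolutelyContinuousOnInterval v D.a D.b
  quasi_eq : ∀ᵐ x ∂(volume.restrict (Set.Ioo D.a D.b)), v x = (D.p x : ℂ) * deriv y x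

/-- The expression `τ y = (1/r) (-(y^{[1]})' + q y)`, where `v = y^{[1]}`. -/
noncomputable def tau (y v : ℝ → ℂ) (x : ℝ) : ℂ :=
  (1 / (D.r x : ℂ)) * (-deriv v x + (D.q x : ℂ) * y x)

/-- The class `f ∈ L²((a,b); r dx)` is represented by `y` with `y, v = y^{[1]} ∈ AC([a,b])`,
and `h ∈ L²((a,b); r dx)` is the class of `τ y`. -/
structure Represents (f h : D.H) (y v : ℝ → ℂ) : Prop where
  pair : D.IsQuasiPair y v
  coe_eq : f =ᵐ[D.μ] y
  tau_eq : h =ᵐ[D.μ] D.tau y v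

/-- The space of boundary values `((g(a), g^{[1]}(a)), (g(b), g^{[1]}(b)))`. -/
abbrev BoundarySpace : Type := (Fin 2 → ℂ) × (Fin 2 → ℂ)

/-- The boundary values of `y` with quasi-derivative `v`. -/
def boundaryValues (y v : ℝ → ℂ) : BoundarySpace := (![y D.a, v D.a], ![y D.b, v D.b])

variable {D}

theorem ae_μ_of_ae {P : ℝ → Prop} (h : ∀ᵐ x ∂(volume.restrict (Set.Ioo D.a D.b)), P x) :
    ∀ᵐ x ∂D.μ, P x :=
  (withDensity_absolutelyContinuous _ _).ae_le h

theorem ae_of_ae_μ {P : ℝ → Prop} (h : ∀ᵐ x ∂D.μ, P x) :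
    ∀ᵐ x ∂(volume.restrict (Set.Ioo D.a D.b)), P x := by
  have hr : AEMeasurable (fun x => ENNReal.ofReal (D.r x))
      (volume.restrict (Set.Ioo D.a D.b)) := D.r_int.aemeasurable.ennreal_ofReal
  rw [μ, ae_withDensity_iff' hr] at h
  filter_upwards [h, D.r_pos] with x hx hrx
  exact hx (by simpa using hrx)

theorem ae_differentiableAt_of_ac {y : ℝ → ℂ} (h : AbsolutelyContinuousOnInterval y D.a D.b) :
    ∀ᵐ x ∂(volume.restrict (Set.Ioo D.a D.b)), DifferentiableAt ℝ y x := by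
  have h1 := h.boundedVariationOn.ae_differentiableAt_of_mem_uIcc
  rw [ae_restrict_iff' measurableSet_Ioo]
  filter_upwards [h1] with x hx hxm
  apply hx
  rw [Set.uIcc_of_le D.a_lt_b.le]
  exact Set.Ioo_subset_Icc_self hxm

theorem IsQuasiPair.add {y v y' v' : ℝ → ℂ} (h : D.IsQuasiPair y v) (h' : D.IsQuasiPair y' v') :
    D.IsQuasiPair (y + y') (v + v') where
  ac := h.ac.add h'.ac
  ac_quasi := h.ac_quasi.add h'.ac_quasi
  quasi_eq := by
    filter_upwards [h.quasi_eq, h'.quasi_eq, ae_differentiableAt_of_ac h.ac,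
      ae_differentiableAt_of_ac h'.ac] with x h1 h2 h3 h4
    rw [Pi.add_apply, h1, h2, deriv_add h3 h4, mul_add]

theorem IsQuasiPair.smul {y v : ℝ → ℂ} (c : ℂ) (h : D.IsQuasiPair y v) :
    D.IsQuasiPair (c • y) (c • v) where
  ac := h.ac.const_smul c
  ac_quasi := h.ac_quasi.const_smul c
  quasi_eq := by
    filter_upwards [h.quasi_eq] with x h1
    rw [Pi.smul_apply, h1, deriv_const_smul_field, smul_eq_mul, smul_eq_mul]
    ring

theorem Represents.add {f h f' h' : D.H} {y v y' v' : ℝ → ℂ} (R : D.Represents f h y v)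
    (R' : D.Represents f' h' y' v') : D.Represents (f + f') (h + h') (y + y') (v + v') where
  pair := R.pair.add R'.pair
  coe_eq := (Lp.coeFn_add f f').trans (R.coe_eq.add R'.coe_eq)
  tau_eq := by
    filter_upwards [Lp.coeFn_add h h', R.tau_eq, R'.tau_eq,
      ae_μ_of_ae (ae_differentiableAt_of_ac R.pair.ac_quasi),
      ae_μ_of_ae (ae_differentiableAt_of_ac R'.pair.ac_quasi)] with x h1 h2 h3 h4 h5
    rw [h1, Pi.add_apply, h2, h3, tau, tau, tau, deriv_add h4 h5, Pi.add_apply]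
    ring

theorem Represents.smul {f h : D.H} {y v : ℝ → ℂ} (c : ℂ) (R : D.Represents f h y v) :
    D.Represents (c • f) (c • h) (c • y) (c • v) where
  pair := R.pair.smul c
  coe_eq := (Lp.coeFn_smul c f).trans (R.coe_eq.const_smul c)
  tau_eq := by
    filter_upwards [Lp.coeFn_smul c h, R.tau_eq] with x h1 h2
    rw [h1, Pi.smul_apply, h2, tau, tau, deriv_const_smul_field, Pi.smul_apply, smul_eq_mul,
      smul_eq_mul, smul_eq_mul]
    ring

theorem Represents.zero : D.Represents 0 0 0 0 where
  pair := by
    have h : AbsolutelyContinuousOnInterval (0 : ℝ → ℂ) D.a D.b := by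
      rw [absolutelyContinuousOnInterval_iff]
      intro ε hε
      exact ⟨1, one_pos, fun E _ _ => by simpa using hε⟩
    exact ⟨h, h, Filter.Eventually.of_forall fun x => by simp⟩
  coe_eq := Lp.coeFn_zero _ _ _
  tau_eq := by
    filter_upwards [Lp.coeFn_zero ℂ 2 D.μ] with x h1
    rw [h1]; simp [tau]

/-- A continuous function on `[a,b]` vanishing a.e. on `(a,b)` vanishes on `[a,b]`. -/
theorem eqOn_zero_of_ae {y : ℝ → ℂ} (hc : AbsolutelyContinuousOnInterval y D.a D.b)
    (h : ∀ᵐ x ∂(volume.restrict (Set.Ioo D.a D.b)), y x = 0) :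
    Set.EqOn y 0 (Set.Icc D.a D.b) := by
  have hc' : ContinuousOn y (Set.Icc D.a D.b) := by
    have := hc.continuousOn
    rwa [Set.uIcc_of_le D.a_lt_b.le] at this
  have h' : y =ᵐ[volume.restrict (Set.Icc D.a D.b)] (0 : ℝ → ℂ) := by
    rw [← Measure.restrict_congr_set Ioo_ae_eq_Icc]
    exact h
  exact Measure.eqOn_Icc_of_ae_eq volume D.a_lt_b.ne h' hc' continuousOn_const

/-- Elements of `L²((a,b); r dx)` determine `y` and `y^{[1]}` on `[a,b]`. -/
theorem Represents.eqOn_zero {h : D.H} {y v : ℝ → ℂ} (R : D.Represents 0 h y v) :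
    Set.EqOn y 0 (Set.Icc D.a D.b) ∧ Set.EqOn v 0 (Set.Icc D.a D.b) ∧ h = 0 := by
  have hderiv : ∀ {w : ℝ → ℂ}, Set.EqOn w 0 (Set.Icc D.a D.b) →
      ∀ᵐ x ∂(volume.restrict (Set.Ioo D.a D.b)), deriv w x = 0 := by
    intro w hw
    filter_upwards [ae_restrict_mem measurableSet_Ioo] with x hx
    have : w =ᶠ[nhds x] 0 := by
      filter_upwards [isOpen_Ioo.mem_nhds hx] with t ht
      exact hw (Set.Ioo_subset_Icc_self ht)
    rw [this.deriv_eq]; simp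
  have hy : Set.EqOn y 0 (Set.Icc D.a D.b) := by
    apply eqOn_zero_of_ae R.pair.ac
    apply ae_of_ae_μ
    filter_upwards [R.coe_eq, Lp.coeFn_zero ℂ 2 D.μ] with x h1 h2
    rw [← h1, h2]; rfl
  have hv : Set.EqOn v 0 (Set.Icc D.a D.b) := by
    apply eqOn_zero_of_ae R.pair.ac_quasi
    filter_upwards [R.pair.quasi_eq, hderiv hy] with x h1 h2
    rw [h1, h2, mul_zero]
  refine ⟨hy, hv, ?_⟩
  apply Lp.ext
  filter_upwards [R.tau_eq, Lp.coeFn_zero ℂ 2 D.μ, ae_μ_of_ae (hderiv hv),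
    ae_μ_of_ae (ae_restrict_mem measurableSet_Ioo)] with x h1 h2 h3 h4
  rw [h1, h2, tau, h3, hy (Set.Ioo_subset_Icc_self h4)]
  simp

variable (D)

/-! ### The maximal operator and its restrictions by boundary conditions -/

/-- The graph `{(f, τ f)}` of the maximal operator. -/
def maxGraph : Submodule ℂ (D.H × D.H) where
  carrier := {w | ∃ y v, D.Represents w.1 w.2 y v}
  zero_mem' := ⟨0, 0, Represents.zero⟩
  add_mem' := by
    rintro _ _ ⟨y, v, R⟩ ⟨y', v', R'⟩
    exact ⟨_, _, R.add R'⟩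
  smul_mem' := by
    rintro c _ ⟨y, v, R⟩
    exact ⟨_, _, R.smul c⟩

/-- The maximal operator `H_max` in `L²((a,b); r dx)`: `H_max f = τ f` on all `f` with
`f, f^{[1]} ∈ AC([a,b])` and `τ f ∈ L²((a,b); r dx)`. -/
noncomputable def Hmax : D.H →ₗ.[ℂ] D.H := D.maxGraph.toLinearPMap

/-- `H_max` is well defined: its graph consists exactly of the pairs `(f, τ f)`. -/
theorem Hmax_graph : D.Hmax.graph = D.maxGraph := by
  apply Submodule.toLinearPMap_graph_eq
  rintro ⟨f, h⟩ ⟨y, v, R⟩ (rfl : f = 0)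
  exact R.eqOn_zero.2.2

/-- The elements of `dom (H_max)` whose boundary values lie in `S`. -/
def bcDomain (S : Submodule ℂ BoundarySpace) : Submodule ℂ D.H where
  carrier := {f | ∃ h y v, D.Represents f h y v ∧ D.boundaryValues y v ∈ S}
  zero_mem' := ⟨0, 0, 0, Represents.zero, by
    have : D.boundaryValues 0 0 = 0 := by simp [boundaryValues]
    rw [this]; exact S.zero_mem⟩
  add_mem' := by
    rintro f f' ⟨h, y, v, R, hS⟩ ⟨h', y', v', R', hS'⟩
    refine ⟨_, _, _, R.add R', ?_⟩
    have : D.boundaryValues (y + y') (v + v')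
        = D.boundaryValues y v + D.boundaryValues y' v' := by
      simp [boundaryValues]
    rw [this]; exact S.add_mem hS hS'
  smul_mem' := by
    rintro c f ⟨h, y, v, R, hS⟩
    refine ⟨_, _, _, R.smul c, ?_⟩
    have : D.boundaryValues (c • y) (c • v) = c • D.boundaryValues y v := by
      simp [boundaryValues]
    rw [this]; exact S.smul_mem c hS

/-- The restriction of `H_max` to the functions whose boundary values lie in `S`. -/
noncomputable def restrictBC (S : Submodule ℂ BoundarySpace) : D.H →ₗ.[ℂ] D.H :=
  D.Hmax.domRestrict (D.bcDomain S)

/-- The minimal operator: `g(a) = g^{[1]}(a) = g(b) = g^{[1]}(b) = 0`. -/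
noncomputable def Hmin : D.H →ₗ.[ℂ] D.H := D.restrictBC ⊥

/-- The boundary conditions `g(a) = g(b) = 0`. -/
def dirichletBC : Submodule ℂ BoundarySpace where
  carrier := {w | w.1 0 = 0 ∧ w.2 0 = 0}
  zero_mem' := by simp
  add_mem' := by
    rintro w w' ⟨h1, h2⟩ ⟨h1', h2'⟩
    simp [h1, h2, h1', h2']
  smul_mem' := by
    rintro c w ⟨h1, h2⟩
    simp [h1, h2]

/-- The Dirichlet operator `H_{0,0}`. -/
noncomputable def Hdir : D.H →ₗ.[ℂ] D.H := D.restrictBC dirichletBC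

/-- The phase `e^{iφ}`. -/
noncomputable def phase (φ : ℝ) : ℂ := Complex.exp (Complex.I * φ)

/-- The coupled boundary conditions `(g(b), g^{[1]}(b))ᵀ = e^{iφ} F (g(a), g^{[1]}(a))ᵀ`. -/
noncomputable def coupledBC (F : Matrix.SpecialLinearGroup (Fin 2) ℝ) (φ : ℝ) :
    Submodule ℂ BoundarySpace where
  carrier := {w | w.2 = phase φ • (F.1.map Complex.ofReal).mulVec w.1}
  zero_mem' := by
    change (0 : Fin 2 → ℂ) = phase φ • (F.1.map Complex.ofReal).mulVec 0
    rw [Matrix.mulVec_zero, smul_zero]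
  add_mem' := by
    intro w w' (h : _ = _) (h' : _ = _)
    change w.2 + w'.2 = phase φ • (F.1.map Complex.ofReal).mulVec (w.1 + w'.1)
    rw [h, h', Matrix.mulVec_add, smul_add]
  smul_mem' := by
    intro c w (h : _ = _)
    change c • w.2 = phase φ • (F.1.map Complex.ofReal).mulVec (c • w.1)
    rw [h, Matrix.mulVec_smul, smul_comm]

/-- The operator `H_{F,φ}`. -/
noncomputable def Hcoupled (F : Matrix.SpecialLinearGroup (Fin 2) ℝ) (φ : ℝ) :
    D.H →ₗ.[ℂ] D.H := D.restrictBC (coupledBC F φ)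

/-- The boundary conditions `g(a) = g(b) = 0`, `g^{[1]}(b) = e^{iφ} F₂₂ g^{[1]}(a)`. -/
noncomputable def commonBC (F : Matrix.SpecialLinearGroup (Fin 2) ℝ) (φ : ℝ) :
    Submodule ℂ BoundarySpace where
  carrier := {w | w.1 0 = 0 ∧ w.2 0 = 0 ∧ w.2 1 = phase φ * (F 1 1 : ℝ) * w.1 1}
  zero_mem' := by simp
  add_mem' := by
    rintro w w' ⟨h1, h2, h3⟩ ⟨h1', h2', h3'⟩
    refine ⟨by simp [h1, h1'], by simp [h2, h2'], ?_⟩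
    simp only [Prod.fst_add, Prod.snd_add, Pi.add_apply, h3, h3']
    ring
  smul_mem' := by
    rintro c w ⟨h1, h2, h3⟩
    refine ⟨by simp [h1], by simp [h2], ?_⟩
    simp only [Prod.smul_fst, Prod.smul_snd, Pi.smul_apply, h3, smul_eq_mul]
    ring

/-! ### The solutions `u₁(z, ·)`, `u₂(z, ·)` -/

/-- `y`, with `v = y^{[1]}`, solves `τ y = z y` on `(a, b)`. -/
structure IsSolution (z : ℂ) (y v : ℝ → ℂ) : Prop where
  pair : D.IsQuasiPair y v
  eqn : ∀ᵐ x ∂(volume.restrict (Set.Ioo D.a D.b)), D.tau y v x = z * y x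

open scoped Classical in
/-- A solution `y` of `τ y = z y` with `y(a) = α`, `y(b) = β`, together with `y^{[1]}`.
For `z ∈ ρ(H_{0,0})` it exists and is unique on `[a,b]`; otherwise `0` is used if there is none. -/
noncomputable def bvpSol (z α β : ℂ) : (ℝ → ℂ) × (ℝ → ℂ) :=
  if h : ∃ w : (ℝ → ℂ) × (ℝ → ℂ), D.IsSolution z w.1 w.2 ∧ w.1 D.a = α ∧ w.1 D.b = β
  then h.choose else 0

/-- `u₁(z, ·)` (with index `0`): `u₁(z, a) = 0`, `u₁(z, b) = 1`; and `u₂(z, ·)` (with index `1`):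
`u₂(z, a) = 1`, `u₂(z, b) = 0`. -/
noncomputable def u (j : Fin 2) (z : ℂ) : ℝ → ℂ := (D.bvpSol z (![0, 1] j) (![1, 0] j)).1

/-- The quasi-derivatives `u_j^{[1]}(z, ·)`. -/
noncomputable def uq (j : Fin 2) (z : ℂ) : ℝ → ℂ := (D.bvpSol z (![0, 1] j) (![1, 0] j)).2

open scoped Classical in
/-- The class in `L²((a,b); r dx)` of a square integrable function (`0` for other functions). -/
noncomputable def toH (y : ℝ → ℂ) : D.H := if h : MemLp y 2 D.μ then h.toLp y else 0

/-- `u_j(z, ·)` as an element of `L²((a,b); r dx)`. -/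
noncomputable def uH (j : Fin 2) (z : ℂ) : D.H := D.toH (D.u j z)

/-! ### The quantities in Krein's formula -/

/-- The matrix `Q_{F,φ}(z)`. -/
noncomputable def Q (F : Matrix.SpecialLinearGroup (Fin 2) ℝ) (φ : ℝ) (z : ℂ) :
    Matrix (Fin 2) (Fin 2) ℂ :=
  !![((F 1 1 : ℝ) : ℂ) / (F 0 1 : ℝ) - D.uq 0 z D.b,
      -1 / (phase (-φ) * (F 0 1 : ℝ)) - D.uq 1 z D.b;
    -1 / (phase φ * (F 0 1 : ℝ)) + D.uq 0 z D.a,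
      ((F 0 0 : ℝ) : ℂ) / (F 0 1 : ℝ) + D.uq 1 z D.a]

/-- The scalar `q_{F,φ}(z)`. -/
noncomputable def qScalar (F : Matrix.SpecialLinearGroup (Fin 2) ℝ) (φ : ℝ) (z : ℂ) : ℂ :=
  (F 1 0 : ℝ) * (F 1 1 : ℝ) + ((F 1 1 : ℝ) : ℂ) ^ 2 * D.uq 1 z D.a
    + phase φ * (F 1 1 : ℝ) * D.uq 0 z D.a
    - phase (-φ) * (F 1 1 : ℝ) * D.uq 1 z D.b - D.uq 0 z D.b

/-- The function `u_{F,φ}(z, ·) = e^{-iφ} F₂₂ u₂(z, ·) + u₁(z, ·)`. -/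
noncomputable def uF (F : Matrix.SpecialLinearGroup (Fin 2) ℝ) (φ : ℝ) (z : ℂ) : D.H :=
  (phase (-φ) * (F 1 1 : ℝ)) • D.uH 1 z + D.uH 0 z

end SturmLiouville

/-! Both operators restrict `Hmax` by conditions on the boundary values, so applied to the same `f`
their resolvents differ by an element of `ker (Hmax - z)`. That kernel is spanned by u₁, u₂: the
initial value problem is solvable (`exists_volterra_solution`), and `z ∈ ρ(H_{0,0})` leaves no
nonzero solution vanishing at both ends. The difference is thus c u₁ + d u₂, and since the Dirichlet
part vanishes at the endpoints, c and d are the values at b and a of the coupled resolvent applied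
to `f`.

The quasi-derivatives of the Dirichlet part at a and b are, by Green's identity
(`IsSolution.inner_eq`), the inner products of `f` with u₂(z̄) and, up to sign, with u₁(z̄). All
boundary values are then explicit in c, d and these two numbers (`resolvent_restrictBC`), and the
coupled condition becomes a linear system for (c, d). For F₁₂ ≠ 0 its matrix is Q (`Q_mulVec`); for
F₁₂ = 0 one equation ties d to c and the other has the coefficient q (`qScalar_mul`). A nontrivial
solution of the homogeneous system would be an eigenvector of H_{F,φ} at z, so Q is invertible and q
≠ 0 on ρ(H_{F,φ}); solving the system is Krein's formula. The common parts come from intersecting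
the two boundary conditions. -/

namespace SturmLiouville

/-! ### Absolutely continuous functions with vector values. -/

section AbsolutelyContinuous

theorem absolutelyContinuous_const {X : Type*} [PseudoMetricSpace X] (c : X) (a b : ℝ) :
    AbsolutelyContinuousOnInterval (fun _ => c) a b :=
  (LipschitzWith.const c).lipschitzOnWith.absolutelyContinuousOnInterval

variable {E : Type*} [NormedAddCommGroup E] [NormedSpace ℝ E]

/-- Primitives of vector valued integrable functions are absolutely continuous. -/
theorem absolutelyContinuous_primitive {f : ℝ → E} {a b : ℝ}
    (hf : IntervalIntegrable f volume a b) :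
    AbsolutelyContinuousOnInterval (fun x => ∫ t in a..x, f t) a b := by
  -- The real primitive of `‖f‖` is absolutely continuous, and its increments dominate those of the
  -- primitive of `f`.
  have hn := hf.norm.absolutelyContinuousOnInterval_intervalIntegral (c := a) Set.left_mem_uIcc
  refine squeeze_zero' (Filter.Eventually.of_forall fun E =>
    Finset.sum_nonneg fun i _ => dist_nonneg) ?_ hn
  have hmem : AbsolutelyContinuousOnInterval.disjWithin a b ∈
      AbsolutelyContinuousOnInterval.totalLengthFilter ⊓
        Filter.principal (AbsolutelyContinuousOnInterval.disjWithin a b) :=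
    Filter.mem_inf_of_right (Filter.mem_principal_self _)
  filter_upwards [hmem] with E hE
  refine Finset.sum_le_sum fun i hi => ?_
  obtain ⟨h1, h2⟩ := hE.1 i hi
  have sub : ∀ {c d}, c ∈ Set.uIcc a b → d ∈ Set.uIcc a b → IntervalIntegrable f volume c d :=
    fun hc hd => hf.mono_set (Set.uIcc_subset_uIcc hc hd)
  have ha : a ∈ Set.uIcc a b := Set.left_mem_uIcc
  rw [dist_comm, dist_comm (∫ t in a..(E.2 i).1, ‖f t‖), dist_eq_norm, dist_eq_norm,
    intervalIntegral.integral_interval_sub_left (sub ha h2) (sub ha h1),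
    intervalIntegral.integral_interval_sub_left (sub ha h2).norm (sub ha h1).norm]
  exact intervalIntegral.norm_integral_le_abs_integral_norm

/-- The fundamental theorem of calculus for vector valued absolutely continuous functions. -/
theorem integral_eq_sub_of_ac {f f' : ℝ → E} [CompleteSpace E] {a b : ℝ} (hab : a ≤ b)
    (hf : AbsolutelyContinuousOnInterval f a b) (hi : IntervalIntegrable f' volume a b)
    (hd : ∀ᵐ x ∂(volume.restrict (Set.Ioo a b)), HasDerivAt f (f' x) x) :
    ∫ x in a..b, f' x = f b - f a := by
  -- `f` minus the primitive of `f'` is absolutely continuous with derivative zero a.e., hence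
  -- constant.
  have hac := hf.sub (absolutelyContinuous_primitive hi)
  have hd' : ∀ᵐ x, x ∈ Set.uIcc a b → HasDerivAt f (f' x) x := by
    rw [Set.uIcc_of_le hab, ← ae_restrict_iff' measurableSet_Icc,
      ← Measure.restrict_congr_set Ioo_ae_eq_Icc]
    exact hd
  obtain ⟨C, hC⟩ := hac.const_of_ae_hasDerivAt_zero (by
    filter_upwards [hd', hi.ae_hasDerivAt_integral] with x h1 h2 hx
    have := (h1 hx).sub (h2 hx a Set.left_mem_uIcc)
    rwa [sub_self] at this)
  have h1 := hC a Set.left_mem_uIcc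
  have h2 := hC b Set.right_mem_uIcc
  simp only [Pi.sub_apply, intervalIntegral.integral_same, sub_zero] at h1 h2
  rw [h1, ← h2, sub_sub_cancel]

theorem _root_.AbsolutelyContinuousOnInterval.pow_real {f : ℝ → ℝ} {a b : ℝ}
    (hf : AbsolutelyContinuousOnInterval f a b) (n : ℕ) :
    AbsolutelyContinuousOnInterval (fun x => f x ^ n) a b := by
  induction n with
  | zero => simpa using absolutelyContinuous_const (1 : ℝ) a b
  | succ n ih => simpa [pow_succ] using ih.fun_mul hf

/-- `∫ P' Pⁿ = Pⁿ⁺¹ / (n + 1)` for a primitive `P` of an integrable function. -/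
theorem integral_mul_primitive_pow {k : ℝ → ℝ} (hk : Integrable k) {a x : ℝ} (hx : a ≤ x) (n : ℕ) :
    ∫ t in a..x, k t * (∫ s in a..t, k s) ^ n = (∫ s in a..x, k s) ^ (n + 1) / (n + 1) := by
  have hP := (absolutelyContinuous_primitive (hk.intervalIntegrable (a := a) (b := x)))
  have h := integral_eq_sub_of_ac (f' := fun t => (n + 1) * (k t * (∫ s in a..t, k s) ^ n)) hx
    (hP.pow_real (n + 1))
    (((hk.intervalIntegrable).mul_continuousOn (hP.pow_real n).continuousOn).const_mul _) (by
      rw [ae_restrict_iff' measurableSet_Ioo]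
      filter_upwards [(hk.intervalIntegrable (a := a) (b := x)).ae_hasDerivAt_integral] with t ht hm
      have := (ht (by rw [Set.uIcc_of_le hx]; exact Set.Ioo_subset_Icc_self hm) a
        Set.left_mem_uIcc).pow (n + 1)
      convert! this using 1
      push_cast
      ring)
  rw [intervalIntegral.integral_const_mul] at h
  have hn : (n + 1 : ℝ) ≠ 0 := by positivity
  rw [eq_div_iff hn, mul_comm, h]
  simp

end AbsolutelyContinuous

/-! ### The initial value problem as a Volterra equation. -/

section Volterra

variable {a b : ℝ} (hab : a ≤ b) {k w : ℝ → ℂ} (hk : Integrable k) (hw : Integrable w)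

theorem integrable_mul_IccExtend {f : ℝ → ℂ} (hf : Integrable f) (y : C(Set.Icc a b, ℂ)) :
    Integrable (fun s => f s * Set.IccExtend hab y s) :=
  hf.mul_bdd (c := ‖y‖) (y.continuous.Icc_extend' (h := hab)).aestronglyMeasurable
    (Filter.Eventually.of_forall fun _ => y.norm_coe_le_norm _)

theorem continuous_primitive_of_integrable {f : ℝ → ℂ} (hf : Integrable f) (a : ℝ) :
    Continuous fun x => ∫ t in a..x, f t :=
  intervalIntegral.continuous_primitive (fun _ _ => hf.intervalIntegrable) a

theorem norm_integral_le_integral_norm_of_integrable {f : ℝ → ℂ} (hf : Integrable f) (a t : ℝ) :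
    ‖∫ s in a..t, f s‖ ≤ ∫ s, ‖f s‖ := by
  refine intervalIntegral.norm_integral_le_integral_norm_uIoc.trans ?_
  exact setIntegral_le_integral hf.norm (Filter.Eventually.of_forall fun _ => norm_nonneg _)

theorem integrable_mul_primitive {f g : ℝ → ℂ} (hf : Integrable f) (hg : Integrable g)
    (a : ℝ) (β : ℂ) : Integrable (fun t => f t * (β + ∫ s in a..t, g s)) := by
  refine hf.mul_bdd (c := ‖β‖ + ∫ s, ‖g s‖)
    (continuous_const.add (continuous_primitive_of_integrable hg a)).aestronglyMeasurable
    (Filter.Eventually.of_forall fun t => (norm_add_le _ _).trans ?_)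
  gcongr
  exact norm_integral_le_integral_norm_of_integrable hg a t

/-- The integral operator `y ↦ α + ∫ k (β + ∫ w y)` on continuous functions on `[a,b]`. -/
noncomputable def volterra (α β : ℂ) (y : C(Set.Icc a b, ℂ)) : C(Set.Icc a b, ℂ) where
  toFun x := α + ∫ t in a..(x : ℝ), k t * (β + ∫ s in a..t, w s * Set.IccExtend hab y s)
  continuous_toFun := continuous_const.add ((continuous_primitive_of_integrable
    (integrable_mul_primitive hk (integrable_mul_IccExtend hab hw y) a β) a).comp
      continuous_subtype_val)

/-- The inner integral is bounded crudely by the total mass of `‖w‖`. Only the outer integration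
against `‖k‖` is tracked: it turns Pⁿ into Pⁿ⁺¹/(n+1), where P is the primitive of `‖k‖`, and so
produces the factorial. -/
theorem norm_iterate_volterra_sub_le (α β : ℂ) (y y' : C(Set.Icc a b, ℂ)) (n : ℕ)
    (x : Set.Icc a b) :
    ‖(volterra hab hk hw α β)^[n] y x - (volterra hab hk hw α β)^[n] y' x‖ ≤
      ((∫ s, ‖w s‖) * ∫ t in a..(x : ℝ), ‖k t‖) ^ n / n.factorial * ‖y - y'‖ := by
  induction n generalizing x with
  | zero => simpa using (y - y').norm_coe_le_norm x
  | succ n ih =>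
    rw [Function.iterate_succ_apply', Function.iterate_succ_apply']
    set Y := (volterra hab hk hw α β)^[n] y
    set Y' := (volterra hab hk hw α β)^[n] y'
    set W := ∫ s, ‖w s‖
    have hW : 0 ≤ W := integral_nonneg fun _ => norm_nonneg _
    set P : ℝ → ℝ := fun x => ∫ t in a..x, ‖k t‖
    have hP0 : ∀ {t}, a ≤ t → 0 ≤ P t := fun h =>
      intervalIntegral.integral_nonneg h fun _ _ => norm_nonneg _
    have hPm : ∀ {s t}, a ≤ s → s ≤ t → P s ≤ P t := fun h1 h2 =>
      intervalIntegral.integral_mono_interval le_rfl h1 h2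
        (Filter.Eventually.of_forall fun _ => norm_nonneg _) hk.norm.intervalIntegrable
    set C := W ^ n / n.factorial * ‖y - y'‖
    have hC : 0 ≤ C := by positivity
    have iw := integrable_mul_IccExtend hab hw
    have ik := fun Y => integrable_mul_primitive hk (iw Y) a β
    have hax : a ≤ (x : ℝ) := x.2.1
    have inner : ∀ t ∈ Set.Icc a (x : ℝ),
        ‖(∫ s in a..t, w s * Set.IccExtend hab Y s) - ∫ s in a..t, w s * Set.IccExtend hab Y' s‖
          ≤ W * (C * P t ^ n) := by
      intro t ht
      rw [← intervalIntegral.integral_sub (iw Y).intervalIntegrable (iw Y').intervalIntegrable]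
      calc _ ≤ ∫ s in a..t, ‖w s‖ * (C * P t ^ n) := by
            refine intervalIntegral.norm_integral_le_of_norm_le ht.1
              (Filter.Eventually.of_forall fun s hs => ?_)
              (hw.norm.mul_const _).intervalIntegrable
            have hs' : s ∈ Set.Icc a b := ⟨hs.1.le, (hs.2.trans ht.2).trans x.2.2⟩
            rw [← mul_sub, norm_mul, Set.IccExtend_of_mem hab _ hs', Set.IccExtend_of_mem hab _ hs']
            gcongr
            refine (ih ⟨s, hs'⟩).trans ?_
            rw [mul_pow]
            have : P s ^ n ≤ P t ^ n := pow_le_pow_left₀ (hP0 hs.1.le) (hPm hs.1.le hs.2) n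
            calc W ^ n * P s ^ n / n.factorial * ‖y - y'‖ = C * P s ^ n := by simp only [C]; ring
              _ ≤ _ := by gcongr
        _ ≤ _ := by
            rw [intervalIntegral.integral_mul_const]
            have : 0 ≤ P t := hP0 ht.1
            gcongr
            rw [intervalIntegral.integral_of_le ht.1]
            exact setIntegral_le_integral hw.norm
              (Filter.Eventually.of_forall fun _ => norm_nonneg _)
    have key : volterra hab hk hw α β Y x - volterra hab hk hw α β Y' x =
        ∫ t in a..(x : ℝ), k t * ((∫ s in a..t, w s * Set.IccExtend hab Y s) -
          ∫ s in a..t, w s * Set.IccExtend hab Y' s) := by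
      change (α + _) - (α + _) = _
      rw [add_sub_add_left_eq_sub, ← intervalIntegral.integral_sub (ik Y).intervalIntegrable
        (ik Y').intervalIntegrable]
      congr 1; ext t; ring
    have hPc : Continuous P :=
      intervalIntegral.continuous_primitive (fun _ _ => hk.norm.intervalIntegrable) a
    rw [key]
    calc _ ≤ ∫ t in a..(x : ℝ), (W * C) * (‖k t‖ * P t ^ n) := by
          refine intervalIntegral.norm_integral_le_of_norm_le hax
            (Filter.Eventually.of_forall fun t ht => ?_)
            ((hk.norm.intervalIntegrable.mul_continuousOn (hPc.pow n).continuousOn).const_mul _)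
          rw [norm_mul]
          refine (mul_le_mul_of_nonneg_left (inner t ⟨ht.1.le, ht.2⟩) (norm_nonneg _)).trans
            (le_of_eq (by ring))
      _ = _ := by
          rw [intervalIntegral.integral_const_mul, integral_mul_primitive_pow hk.norm hax]
          simp only [C]
          rw [Nat.factorial_succ]
          push_cast
          field_simp
          ring

/-- Solvability of the linear initial value problem `y' = k v`, `v' = w y` with integrable
coefficients, in integrated form. -/
theorem exists_volterra_solution {a b : ℝ} (hab : a ≤ b) {k w : ℝ → ℂ} (hk : Integrable k)
    (hw : Integrable w) (α β : ℂ) :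
    ∃ y v : ℝ → ℂ, Continuous y ∧ Continuous v ∧
      (∀ x, v x = β + ∫ t in a..x, w t * y t) ∧
      (∀ x ∈ Set.Icc a b, y x = α + ∫ t in a..x, k t * v t) ∧
      Integrable (fun t => w t * y t) ∧ Integrable (fun t => k t * v t) := by
  set T := volterra hab hk hw α β
  set M := (∫ s, ‖w s‖) * ∫ t in a..b, ‖k t‖
  have hW : 0 ≤ ∫ s, ‖w s‖ := integral_nonneg fun _ => norm_nonneg _
  have hM : 0 ≤ M := mul_nonneg hW
    (intervalIntegral.integral_nonneg hab fun _ _ => norm_nonneg _)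
  -- The operator itself need not contract, but Mⁿ/n! < 1 for some n, so an iterate does; its unique
  -- fixed point is then fixed by the operator too.
  obtain ⟨n, hn⟩ := ((FloorSemiring.tendsto_pow_div_factorial_atTop M).eventually
    (gt_mem_nhds one_pos)).exists
  have hK : 0 ≤ M ^ n / n.factorial := div_nonneg (pow_nonneg hM n) (Nat.cast_nonneg _)
  have hcon : ContractingWith (M ^ n / n.factorial).toNNReal T^[n] := by
    refine ⟨by simpa using hn, LipschitzWith.of_dist_le_mul fun y y' => ?_⟩
    rw [Real.coe_toNNReal _ hK, dist_eq_norm, dist_eq_norm,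
      ContinuousMap.norm_le _ (mul_nonneg hK (norm_nonneg _))]
    intro x
    refine (norm_iterate_volterra_sub_le hab hk hw α β y y' n x).trans ?_
    have h0 : 0 ≤ ∫ t in a..(x : ℝ), ‖k t‖ :=
      intervalIntegral.integral_nonneg x.2.1 fun _ _ => norm_nonneg _
    gcongr
    exact mul_le_mul_of_nonneg_left (intervalIntegral.integral_mono_interval le_rfl x.2.1 x.2.2
        (Filter.Eventually.of_forall fun _ => norm_nonneg _) hk.norm.intervalIntegrable) hW
  have hfix := hcon.isFixedPt_fixedPoint_iterate
  set Y := hcon.fixedPoint T^[n]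
  refine ⟨Set.IccExtend hab Y, fun t => β + ∫ s in a..t, w s * Set.IccExtend hab Y s,
    Y.continuous.Icc_extend', continuous_const.add (continuous_primitive_of_integrable
      (integrable_mul_IccExtend hab hw Y) a), fun x => rfl, fun x hx => ?_,
    integrable_mul_IccExtend hab hw Y,
    integrable_mul_primitive hk (integrable_mul_IccExtend hab hw Y) a β⟩
  rw [Set.IccExtend_of_mem hab _ hx]
  exact (DFunLike.congr_fun hfix.eq ⟨x, hx⟩).symm

end Volterra

/-! ### Resolvents, kernels and common parts in terms of graphs. -/

section Graphs

variable {E : Type*} [NormedAddCommGroup E] [InnerProductSpace ℂ E]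

theorem IsResolventAt.exists_mem_graph {T : E →ₗ.[ℂ] E} {z : ℂ} {R : E →L[ℂ] E}
    (hR : IsResolventAt T z R) (f : E) : ∃ h, (R f, h) ∈ T.graph ∧ h - z • R f = f := by
  obtain ⟨g, hg, hf⟩ := hR.1 f
  exact ⟨T g, by rw [← hg]; exact T.mem_graph g, by rw [← hg]; exact hf⟩

theorem IsResolventAt.apply_of_mem_graph {T : E →ₗ.[ℂ] E} {z : ℂ} {R : E →L[ℂ] E}
    (hR : IsResolventAt T z R) {g h : E} (hg : (g, h) ∈ T.graph) : R (h - z • g) = g := by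
  obtain ⟨g', rfl, rfl⟩ := (LinearPMap.mem_graph_iff T).1 hg
  exact hR.2 g'

theorem eq_zero_of_mem_graph {T : E →ₗ.[ℂ] E} {z : ℂ} (hz : z ∈ resolventSet T) {g : E}
    (hg : (g, z • g) ∈ T.graph) : g = 0 := by
  obtain ⟨R, hR⟩ := hz
  have := hR.apply_of_mem_graph hg
  rwa [sub_self, map_zero, eq_comm] at this

theorem mem_graph_maximalCommonPart {A B : E →ₗ.[ℂ] E} {f h : E} :
    (f, h) ∈ (maximalCommonPart A B).graph ↔ (f, h) ∈ A.graph ∧ (f, h) ∈ B.graph := by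
  constructor
  · intro hf
    exact ⟨LinearPMap.le_graph_of_le inf_le_left hf, LinearPMap.le_graph_of_le inf_le_right hf⟩
  · rintro ⟨hA, hB⟩
    obtain ⟨⟨f, mA⟩, rfl, rfl⟩ := (LinearPMap.mem_graph_iff A).1 hA
    obtain ⟨⟨f', mB⟩, rfl, hAB⟩ := (LinearPMap.mem_graph_iff B).1 hB
    exact (LinearPMap.mem_graph_iff _).2 ⟨⟨f', ⟨mA, mB, hAB.symm⟩⟩, rfl, rfl⟩

theorem mem_kernelAt_iff {T : E →ₗ.[ℂ] E} {z : ℂ} {f : E} :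
    f ∈ kernelAt T z ↔ (f, z • f) ∈ T.graph := by
  rw [LinearPMap.mem_graph_iff]
  constructor
  · rintro ⟨h, e⟩
    exact ⟨⟨f, h⟩, rfl, e⟩
  · rintro ⟨⟨f', h⟩, rfl, e⟩
    exact ⟨h, e⟩

end Graphs

/-! ### Boundary values and restrictions of the maximal operator. -/

variable {D : SturmLiouville}

theorem Represents.sub {f h f' h' : D.H} {y v y' v' : ℝ → ℂ} (R : D.Represents f h y v)
    (R' : D.Represents f' h' y' v') : D.Represents (f - f') (h - h') (y - y') (v - v') := by
  have := R.add (R'.smul (-1))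
  simpa only [neg_smul, one_smul, ← sub_eq_add_neg] using this

theorem Represents.eqOn {f h h' : D.H} {y v y' v' : ℝ → ℂ} (R : D.Represents f h y v)
    (R' : D.Represents f h' y' v') :
    Set.EqOn y y' (Set.Icc D.a D.b) ∧ Set.EqOn v v' (Set.Icc D.a D.b) ∧ h = h' := by
  have R0 := R.sub R'
  rw [sub_self] at R0
  obtain ⟨h1, h2, h3⟩ := R0.eqOn_zero
  exact ⟨fun x hx => sub_eq_zero.1 (h1 hx), fun x hx => sub_eq_zero.1 (h2 hx), sub_eq_zero.1 h3⟩

theorem left_mem (D : SturmLiouville) : D.a ∈ Set.Icc D.a D.b := Set.left_mem_Icc.2 D.a_lt_b.le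

theorem right_mem (D : SturmLiouville) : D.b ∈ Set.Icc D.a D.b := Set.right_mem_Icc.2 D.a_lt_b.le

theorem Represents.boundaryValues_eq {f h h' : D.H} {y v y' v' : ℝ → ℂ}
    (R : D.Represents f h y v) (R' : D.Represents f h' y' v') :
    D.boundaryValues y v = D.boundaryValues y' v' := by
  obtain ⟨h1, h2, -⟩ := R.eqOn R'
  simp [boundaryValues, h1 D.left_mem, h1 D.right_mem, h2 D.left_mem, h2 D.right_mem]

theorem mem_Hmax_graph {f h : D.H} :
    (f, h) ∈ D.Hmax.graph ↔ ∃ y v, D.Represents f h y v := by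
  rw [Hmax_graph]; rfl

/-- The graph and the domain may supply different representatives; their boundary values agree, so
the condition can be tested on any one of them. -/
theorem mem_restrictBC_graph {S : Submodule ℂ BoundarySpace} {f h : D.H} :
    (f, h) ∈ (D.restrictBC S).graph ↔
      ∃ y v, D.Represents f h y v ∧ D.boundaryValues y v ∈ S := by
  constructor
  · intro hf
    obtain ⟨y, v, R⟩ := mem_Hmax_graph.1 (LinearPMap.le_graph_of_le LinearPMap.domRestrict_le hf)
    obtain ⟨⟨f', mf⟩, rfl, -⟩ := (LinearPMap.mem_graph_iff _).1 hf
    obtain ⟨h', y', v', R', hS⟩ := mf.1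
    exact ⟨y, v, R, by rwa [R.boundaryValues_eq R']⟩
  · rintro ⟨y, v, R, hS⟩
    obtain ⟨⟨f', mf⟩, rfl, rfl⟩ := (LinearPMap.mem_graph_iff _).1 (mem_Hmax_graph.2 ⟨y, v, R⟩)
    exact (LinearPMap.mem_graph_iff _).2 ⟨⟨f', ⟨⟨_, y, v, R, hS⟩, mf⟩⟩, rfl, rfl⟩

/-- The maximal common part of two restrictions of `H_max` satisfies both boundary conditions. -/
theorem maximalCommonPart_restrictBC (S S' : Submodule ℂ BoundarySpace) :
    maximalCommonPart (D.restrictBC S) (D.restrictBC S') = D.restrictBC (S ⊓ S') := by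
  apply LinearPMap.eq_of_eq_graph
  ext ⟨f, h⟩
  rw [mem_graph_maximalCommonPart, mem_restrictBC_graph, mem_restrictBC_graph,
    mem_restrictBC_graph]
  constructor
  · rintro ⟨⟨y, v, R, hS⟩, ⟨y', v', R', hS'⟩⟩
    exact ⟨y, v, R, hS, by rwa [R.boundaryValues_eq R']⟩
  · rintro ⟨y, v, R, hS, hS'⟩
    exact ⟨⟨y, v, R, hS⟩, ⟨y, v, R, hS'⟩⟩

/-! ### Solutions of `τ y = z y` -/

instance : IsFiniteMeasure D.μ := isFiniteMeasure_withDensity_ofReal D.r_int.2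

theorem IsQuasiPair.memLp {y v : ℝ → ℂ} (h : D.IsQuasiPair y v) : MemLp y 2 D.μ := by
  obtain ⟨C, hC⟩ := h.ac.exists_bound
  have hc := h.ac.continuousOn
  rw [Set.uIcc_of_le D.a_lt_b.le] at hC hc
  have hm : AEStronglyMeasurable y (volume.restrict (Set.Ioo D.a D.b)) :=
    (hc.mono Set.Ioo_subset_Icc_self).aestronglyMeasurable measurableSet_Ioo
  refine MemLp.of_bound (hm.mono_ac (withDensity_absolutelyContinuous _ _)) C (ae_μ_of_ae ?_)
  filter_upwards [ae_restrict_mem measurableSet_Ioo] with x hx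
  exact hC x (Set.Ioo_subset_Icc_self hx)

theorem coeFn_toH {y : ℝ → ℂ} (h : MemLp y 2 D.μ) : D.toH y =ᵐ[D.μ] y := by
  rw [toH, dif_pos h]
  exact h.coeFn_toLp

theorem IsSolution.represents {z : ℂ} {y v : ℝ → ℂ} (h : D.IsSolution z y v) :
    D.Represents (D.toH y) (z • D.toH y) y v where
  pair := h.pair
  coe_eq := coeFn_toH h.pair.memLp
  tau_eq := by
    filter_upwards [Lp.coeFn_smul z (D.toH y), coeFn_toH h.pair.memLp, ae_μ_of_ae h.eqn]
      with x h1 h2 h3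
    rw [h1, Pi.smul_apply, h2, h3, smul_eq_mul]

/-- Together with `IsSolution.represents` this identifies solutions with kernel elements of `Hmax -
z`. Passing from a.e. for r dx to a.e. for dx uses r > 0. -/
theorem Represents.isSolution {z : ℂ} {f : D.H} {y v : ℝ → ℂ}
    (R : D.Represents f (z • f) y v) : D.IsSolution z y v where
  pair := R.pair
  eqn := by
    apply ae_of_ae_μ
    filter_upwards [Lp.coeFn_smul z f, R.coe_eq, R.tau_eq] with x h1 h2 h3
    rw [← h3, h1, Pi.smul_apply, h2, smul_eq_mul]

theorem IsSolution.add {z : ℂ} {y v y' v' : ℝ → ℂ} (h : D.IsSolution z y v)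
    (h' : D.IsSolution z y' v') : D.IsSolution z (y + y') (v + v') := by
  have := h.represents.add h'.represents
  rw [← smul_add] at this
  exact this.isSolution

theorem IsSolution.smul {z : ℂ} {y v : ℝ → ℂ} (c : ℂ) (h : D.IsSolution z y v) :
    D.IsSolution z (c • y) (c • v) := by
  have := h.represents.smul c
  rw [smul_comm] at this
  exact this.isSolution

/-- For a.e. `x`, a solution satisfies `(y^{[1]})' = (q - z r) y`. -/
theorem IsSolution.deriv_quasi {z : ℂ} {y v : ℝ → ℂ} (h : D.IsSolution z y v) :
    ∀ᵐ x ∂(volume.restrict (Set.Ioo D.a D.b)),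
      deriv v x = ((D.q x : ℂ) - z * (D.r x : ℂ)) * y x := by
  filter_upwards [h.eqn, D.r_pos] with x h1 h2
  have hr : (D.r x : ℂ) ≠ 0 := by exact_mod_cast h2.ne'
  rw [tau] at h1
  field_simp at h1
  linear_combination -h1

theorem ac_conj {y : ℝ → ℂ} (h : AbsolutelyContinuousOnInterval y D.a D.b) :
    AbsolutelyContinuousOnInterval (fun x => star (y x)) D.a D.b := by
  unfold AbsolutelyContinuousOnInterval at h ⊢
  simpa only [dist_star_star] using h

/-- Complex conjugation maps solutions for `z` to solutions for `z̄`. -/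
theorem IsSolution.conj {z : ℂ} {y v : ℝ → ℂ} (h : D.IsSolution z y v) :
    D.IsSolution (star z) (fun x => star (y x)) (fun x => star (v x)) where
  pair :=
    { ac := ac_conj h.pair.ac
      ac_quasi := ac_conj h.pair.ac_quasi
      quasi_eq := by
        filter_upwards [h.pair.quasi_eq] with x h1
        rw [deriv.star, h1, star_mul']
        simp }
  eqn := by
    filter_upwards [h.eqn] with x h1
    rw [← star_mul', ← h1, tau, tau, deriv.star]
    simp

/-- Solvability of the initial value problem for `τ y = z y`. -/
theorem exists_isSolution_ivp (D : SturmLiouville) (z α β : ℂ) :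
    ∃ y v, D.IsSolution z y v ∧ y D.a = α ∧ v D.a = β := by
  have hab := D.a_lt_b.le
  -- The system is y' = (1/p) v, v' = (q - z r) y, with coefficients extended by zero so that they
  -- are integrable on the whole line.
  obtain ⟨k, hk⟩ : ∃ k : ℝ → ℂ, k = (Set.Ioo D.a D.b).indicator (fun x => ((1 / D.p x : ℝ) : ℂ)) :=
    ⟨_, rfl⟩
  obtain ⟨w, hw⟩ : ∃ w : ℝ → ℂ, w = (Set.Ioo D.a D.b).indicator
    (fun x => (D.q x : ℂ) - z * (D.r x : ℂ)) := ⟨_, rfl⟩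
  have ik : Integrable k := by
    rw [hk, integrable_indicator_iff measurableSet_Ioo]
    exact D.p_int.ofReal
  have iw : Integrable w := by
    rw [hw, integrable_indicator_iff measurableSet_Ioo]
    exact D.q_int.ofReal.sub (D.r_int.ofReal.const_mul z)
  obtain ⟨Y, v, -, -, hv, hY, iY, iv⟩ := exists_volterra_solution hab ik iw α β
  have hder : ∀ {g : ℝ → ℂ} (γ : ℂ), Integrable g → ∀ᵐ x ∂(volume.restrict (Set.Ioo D.a D.b)),
      HasDerivAt (fun x => γ + ∫ t in D.a..x, g t) (g x) x := by
    intro g γ hg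
    rw [ae_restrict_iff' measurableSet_Ioo]
    filter_upwards [(hg.intervalIntegrable (a := D.a) (b := D.b)).ae_hasDerivAt_integral]
      with x hx hm
    refine (hx ?_ D.a Set.left_mem_uIcc).const_add γ
    rw [Set.uIcc_of_le hab]
    exact Set.Ioo_subset_Icc_self hm
  have hac : ∀ {g : ℝ → ℂ} (γ : ℂ), Integrable g →
      AbsolutelyContinuousOnInterval (fun x => γ + ∫ t in D.a..x, g t) D.a D.b := fun γ hg =>
    (absolutelyContinuous_const γ _ _).add (absolutelyContinuous_primitive hg.intervalIntegrable)
  have hv' : v = fun x => β + ∫ t in D.a..x, w t * Y t := funext hv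
  -- The primitive replaces `Y`, with which it agrees on [a,b]; absolute continuity and the a.e.
  -- derivative are then immediate.
  refine ⟨fun x => α + ∫ t in D.a..x, k t * v t, v, ⟨⟨hac α iv, hv' ▸ hac β iY, ?_⟩, ?_⟩,
    by simp, by simp [hv]⟩
  · filter_upwards [hder α iv, D.p_pos, ae_restrict_mem measurableSet_Ioo] with x h1 h2 h3
    have hp : (D.p x : ℂ) ≠ 0 := by exact_mod_cast h2.ne'
    rw [h1.deriv, hk, Set.indicator_of_mem h3]
    push_cast
    field_simp
  · filter_upwards [hder β iY, D.r_pos, ae_restrict_mem measurableSet_Ioo] with x h1 h2 h3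
    have hr : (D.r x : ℂ) ≠ 0 := by exact_mod_cast h2.ne'
    rw [← hv'] at h1
    rw [tau, h1.deriv, hw, Set.indicator_of_mem h3, hY x (Set.Ioo_subset_Icc_self h3)]
    field_simp
    ring

/-- Such a solution lies in the kernel of `Hdir - z`, which is trivial on the resolvent set. -/
theorem IsSolution.eqOn_zero_of_dirichlet {z : ℂ} (hz : z ∈ resolventSet D.Hdir) {y v : ℝ → ℂ}
    (h : D.IsSolution z y v) (ha : y D.a = 0) (hb : y D.b = 0) :
    Set.EqOn y 0 (Set.Icc D.a D.b) ∧ Set.EqOn v 0 (Set.Icc D.a D.b) := by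
  have R := h.represents
  have h0 : D.toH y = 0 := eq_zero_of_mem_graph hz (mem_restrictBC_graph.2 ⟨y, v, R, ha, hb⟩)
  rw [h0] at R
  exact ⟨R.eqOn_zero.1, R.eqOn_zero.2.1⟩

theorem exists_isSolution_bvp {z : ℂ} (hz : z ∈ resolventSet D.Hdir) (α β : ℂ) :
    ∃ y v, D.IsSolution z y v ∧ y D.a = α ∧ y D.b = β := by
  obtain ⟨s, s', hs, hsa, hsa'⟩ := D.exists_isSolution_ivp z 0 1
  obtain ⟨c, c', hc, hca, -⟩ := D.exists_isSolution_ivp z 1 0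
  -- If s(b) = 0, then s would be a Dirichlet solution, hence zero, against s^{[1]}(a) = 1. A
  -- multiple of s can therefore correct the value at b without changing the one at a.
  have hne : s D.b ≠ 0 := fun h0 => by
    have := (hs.eqOn_zero_of_dirichlet hz hsa h0).2 D.left_mem
    simp [hsa'] at this
  refine ⟨_, _, (hc.smul α).add (hs.smul ((β - α * c D.b) / s D.b)), ?_, ?_⟩
  · simp [hsa, hca]
  · simp [hne]

theorem bvpSol_spec {z α β : ℂ} (h : ∃ y v, D.IsSolution z y v ∧ y D.a = α ∧ y D.b = β) :
    D.IsSolution z (D.bvpSol z α β).1 (D.bvpSol z α β).2 ∧ (D.bvpSol z α β).1 D.a = α ∧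
      (D.bvpSol z α β).1 D.b = β := by
  have h' : ∃ w : (ℝ → ℂ) × (ℝ → ℂ), D.IsSolution z w.1 w.2 ∧ w.1 D.a = α ∧ w.1 D.b = β := by
    obtain ⟨y, v, hy⟩ := h
    exact ⟨(y, v), hy⟩
  rw [bvpSol, dif_pos h']
  exact h'.choose_spec

theorem u_spec {z : ℂ} (hz : z ∈ resolventSet D.Hdir) (j : Fin 2) :
    D.IsSolution z (D.u j z) (D.uq j z) ∧ D.u j z D.a = ![0, 1] j ∧ D.u j z D.b = ![1, 0] j :=
  bvpSol_spec (exists_isSolution_bvp hz _ _)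

/-- The coefficients are real, so conjugating solutions for z gives solvability at z̄; `z̄ ∈
ρ(H_{0,0})` is not needed. Uniqueness at z̄ is not needed either, since Green's identity will use
only these boundary values. -/
theorem u_conj_spec {z : ℂ} (hz : z ∈ resolventSet D.Hdir) (j : Fin 2) :
    D.IsSolution (star z) (D.u j (star z)) (D.uq j (star z)) ∧
      D.u j (star z) D.a = ![0, 1] j ∧ D.u j (star z) D.b = ![1, 0] j := by
  refine bvpSol_spec ?_
  obtain ⟨y, v, h, ha, hb⟩ := exists_isSolution_bvp hz (![0, 1] j) (![1, 0] j)
  refine ⟨_, _, h.conj, ?_, ?_⟩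
  · rw [ha]; fin_cases j <;> simp
  · rw [hb]; fin_cases j <;> simp

/-- The expansion of a solution in `u₁`, `u₂`. -/
theorem IsSolution.expand {z : ℂ} (hz : z ∈ resolventSet D.Hdir) {y v : ℝ → ℂ}
    (h : D.IsSolution z y v) :
    Set.EqOn y (y D.b • D.u 0 z + y D.a • D.u 1 z) (Set.Icc D.a D.b) ∧
      Set.EqOn v (y D.b • D.uq 0 z + y D.a • D.uq 1 z) (Set.Icc D.a D.b) := by
  obtain ⟨h0, h0a, h0b⟩ := u_spec hz 0
  obtain ⟨h1, h1a, h1b⟩ := u_spec hz 1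
  have hs := h.add (((h0.smul (y D.b)).add (h1.smul (y D.a))).smul (-1))
  have := hs.eqOn_zero_of_dirichlet hz (by simp [h0a, h1a]) (by simp [h0b, h1b])
  simp only [neg_smul, one_smul, ← sub_eq_add_neg] at this
  exact ⟨fun x hx => sub_eq_zero.1 (this.1 hx), fun x hx => sub_eq_zero.1 (this.2 hx)⟩

theorem uH_combination {z : ℂ} (hz : z ∈ resolventSet D.Hdir) (c d : ℂ) :
    D.Represents (c • D.uH 0 z + d • D.uH 1 z) (z • (c • D.uH 0 z + d • D.uH 1 z))
      (c • D.u 0 z + d • D.u 1 z) (c • D.uq 0 z + d • D.uq 1 z) := by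
  have := ((u_spec hz 0).1.represents.smul c).add ((u_spec hz 1).1.represents.smul d)
  rw [smul_comm c, smul_comm d, ← smul_add] at this
  exact this

theorem Represents.expand {z : ℂ} (hz : z ∈ resolventSet D.Hdir) {f : D.H} {y v : ℝ → ℂ}
    (R : D.Represents f (z • f) y v) : f = y D.b • D.uH 0 z + y D.a • D.uH 1 z := by
  have R' := uH_combination hz (y D.b) (y D.a)
  apply Lp.ext
  filter_upwards [R.coe_eq, R'.coe_eq, ae_μ_of_ae (ae_restrict_mem measurableSet_Ioo)]
    with x h1 h2 h3
  rw [h1, h2, (R.isSolution.expand hz).1 (Set.Ioo_subset_Icc_self h3)]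

theorem linearIndependent_uH {z : ℂ} (hz : z ∈ resolventSet D.Hdir) :
    LinearIndependent ℂ (fun j => D.uH j z) := by
  rw [Fintype.linearIndependent_iff]
  intro c hc
  rw [Fin.sum_univ_two] at hc
  have R := uH_combination hz (c 0) (c 1)
  rw [hc] at R
  -- Evaluation at a isolates the coefficient of u₂, evaluation at b that of u₁.
  have ha := R.eqOn_zero.1 D.left_mem
  have hb := R.eqOn_zero.1 D.right_mem
  simp [u_spec hz] at ha hb
  intro j
  fin_cases j
  · exact hb
  · exact ha

theorem span_uH {z : ℂ} (hz : z ∈ resolventSet D.Hdir) :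
    Submodule.span ℂ (Set.range fun j => D.uH j z) = kernelAt D.Hmax z := by
  apply le_antisymm
  · rw [Submodule.span_le]
    rintro _ ⟨j, rfl⟩
    exact mem_kernelAt_iff.2 (mem_Hmax_graph.2 ⟨_, _, (u_spec hz j).1.represents⟩)
  · intro f hf
    obtain ⟨y, v, R⟩ := mem_Hmax_graph.1 (mem_kernelAt_iff.1 hf)
    rw [R.expand hz]
    exact add_mem (Submodule.smul_mem _ _ (Submodule.subset_span ⟨0, rfl⟩))
      (Submodule.smul_mem _ _ (Submodule.subset_span ⟨1, rfl⟩))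

/-! ### Green's identity and the difference of resolvents. -/

/-- Green's identity for a solution of `τ u = z̄ u` and an element of `dom (H_max)`. -/
theorem IsSolution.inner_eq {z : ℂ} {s s' : ℝ → ℂ} (hs : D.IsSolution (star z) s s')
    {g h : D.H} {y v : ℝ → ℂ} (R : D.Represents g h y v) :
    inner ℂ (D.toH s) (h - z • g) =
      (star (s' D.b) * y D.b - star (s D.b) * v D.b)
        - (star (s' D.a) * y D.a - star (s D.a) * v D.a) := by
  have hab := D.a_lt_b.le
  have hc := hs.conj
  rw [star_star] at hc
  set U := D.toH s
  set f := h - z • g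
  have hr : AEMeasurable (fun x => ENNReal.ofReal (D.r x))
      (volume.restrict (Set.Ioo D.a D.b)) := D.r_int.aemeasurable.ennreal_ofReal
  have htop : ∀ᵐ x ∂(volume.restrict (Set.Ioo D.a D.b)), ENNReal.ofReal (D.r x) < ⊤ :=
    Filter.Eventually.of_forall fun _ => ENNReal.ofReal_lt_top
  set φ : ℝ → ℂ := fun x => (ENNReal.ofReal (D.r x)).toReal • inner ℂ (U x) (f x)
  have hint : IntegrableOn φ (Set.Ioo D.a D.b) :=
    (integrable_withDensity_iff_integrable_smul₀' hr htop).1 (L2.integrable_inner U f)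
  have hint' : IntervalIntegrable φ volume D.a D.b := by
    rw [intervalIntegrable_iff_integrableOn_Ioo_of_le hab]
    exact hint
  have hW : AbsolutelyContinuousOnInterval
      (fun x => star (s' x) * y x - star (s x) * v x) D.a D.b :=
    (hc.pair.ac_quasi.fun_smul R.pair.ac).fun_sub (hc.pair.ac.fun_smul R.pair.ac_quasi)
  have hval : ∀ᵐ x ∂(volume.restrict (Set.Ioo D.a D.b)),
      U x = s x ∧ f x = D.tau y v x - z * y x := by
    apply ae_of_ae_μ
    filter_upwards [coeFn_toH hs.pair.memLp, Lp.coeFn_sub h (z • g), Lp.coeFn_smul z g, R.coe_eq,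
      R.tau_eq] with x h1 h2 h3 h4 h5
    refine ⟨h1, ?_⟩
    rw [h2, Pi.sub_apply, h3, Pi.smul_apply, h4, h5, smul_eq_mul]
  -- In the derivative of the Wronskian-type expression the two terms p s̄' y' cancel, leaving r s̄
  -- (τy - zy), the integrand of the inner product.
  have hd : ∀ᵐ x ∂(volume.restrict (Set.Ioo D.a D.b)),
      HasDerivAt (fun x => star (s' x) * y x - star (s x) * v x) (φ x) x := by
    filter_upwards [hval, ae_differentiableAt_of_ac hc.pair.ac,
      ae_differentiableAt_of_ac hc.pair.ac_quasi, ae_differentiableAt_of_ac R.pair.ac,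
      ae_differentiableAt_of_ac R.pair.ac_quasi, hc.pair.quasi_eq, R.pair.quasi_eq,
      hc.deriv_quasi, D.r_pos] with x h1 d1 d2 d3 d4 e1 e2 e3 hrx
    have hr0 : (D.r x : ℂ) ≠ 0 := by exact_mod_cast hrx.ne'
    convert! (d2.hasDerivAt.mul d3.hasDerivAt).sub (d1.hasDerivAt.mul d4.hasDerivAt) using 1
    simp only [φ]
    rw [h1.1, h1.2, ENNReal.toReal_ofReal hrx.le, e1, e2, e3, RCLike.inner_apply, tau,
      Complex.real_smul, starRingEnd_apply]
    field_simp
    ring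
  rw [← integral_eq_sub_of_ac hab hW hint' hd, L2.inner_def,
    intervalIntegral.integral_of_le hab, integral_Ioc_eq_integral_Ioo]
  exact integral_withDensity_eq_integral_toReal_smul₀ hr htop _

/-- The difference of the resolvents of a restriction of `H_max` and of the Dirichlet operator. -/
theorem resolvent_restrictBC {S : Submodule ℂ BoundarySpace} {z : ℂ}
    (hS : z ∈ resolventSet (D.restrictBC S)) (hz : z ∈ resolventSet D.Hdir) (f : D.H) :
    ∃ c d : ℂ, resolvent (D.restrictBC S) z f =
        resolvent D.Hdir z f + (c • D.uH 0 z + d • D.uH 1 z) ∧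
      ((![d, inner ℂ (D.uH 1 (star z)) f + (c * D.uq 0 z D.a + d * D.uq 1 z D.a)],
        ![c, -inner ℂ (D.uH 0 (star z)) f + (c * D.uq 0 z D.b + d * D.uq 1 z D.b)]) :
          BoundarySpace) ∈ S := by
  obtain ⟨h, hg, hf⟩ := (isResolventAt_resolvent hS).exists_mem_graph f
  obtain ⟨h₀, hg₀, hf₀⟩ := (isResolventAt_resolvent hz).exists_mem_graph f
  set g := resolvent (D.restrictBC S) z f
  set g₀ := resolvent D.Hdir z f
  obtain ⟨y, v, R, hbv⟩ := mem_restrictBC_graph.1 hg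
  obtain ⟨y₀, v₀, R₀, ha₀, hb₀⟩ := mem_restrictBC_graph.1 hg₀
  replace ha₀ : y₀ D.a = 0 := ha₀
  replace hb₀ : y₀ D.b = 0 := hb₀
  have Rd := R.sub R₀
  -- Both resolvents solve the same inhomogeneous equation, so their difference solves the
  -- homogeneous one.
  have hz' : h - h₀ = z • (g - g₀) := by
    rw [smul_sub, sub_eq_sub_iff_sub_eq_sub, hf, hf₀]
  rw [hz'] at Rd
  have hexp := Rd.expand hz
  have hv := (Rd.isSolution.expand hz).2
  simp only [Pi.sub_apply, ha₀, hb₀, sub_zero] at hexp hv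
  have hva := hv D.left_mem
  have hvb := hv D.right_mem
  simp only [Pi.sub_apply, Pi.add_apply, Pi.smul_apply, smul_eq_mul] at hva hvb
  -- In Green's identity y₀ vanishes at both ends and u₁ at a, so only the term with v₀(b) survives;
  -- for u₂ it is the one with v₀(a).
  have hi0 : inner ℂ (D.uH 0 (star z)) f = -v₀ D.b := by
    obtain ⟨hu, hua, hub⟩ := u_conj_spec hz 0
    have := hu.inner_eq R₀
    rw [hf₀, ha₀, hb₀, hua, hub] at this
    refine this.trans ?_
    simp
  have hi1 : inner ℂ (D.uH 1 (star z)) f = v₀ D.a := by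
    obtain ⟨hu, hua, hub⟩ := u_conj_spec hz 1
    have := hu.inner_eq R₀
    rw [hf₀, ha₀, hb₀, hua, hub] at this
    refine this.trans ?_
    simp
  refine ⟨y D.b, y D.a, ?_, ?_⟩
  · rw [← hexp, add_sub_cancel]
  · rw [hi0, hi1, ← hva, ← hvb, neg_neg, add_sub_cancel, add_sub_cancel]
    exact hbv

/-- The vectors are the boundary values of c u₁ + d u₂, which would otherwise be an eigenvector at a
point of the resolvent set. This gives the invertibility of Q and q ≠ 0. -/
theorem eq_zero_of_boundaryValues_mem {S : Submodule ℂ BoundarySpace} {z : ℂ}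
    (hS : z ∈ resolventSet (D.restrictBC S)) (hz : z ∈ resolventSet D.Hdir) {c d : ℂ}
    (h : ((![d, c * D.uq 0 z D.a + d * D.uq 1 z D.a],
      ![c, c * D.uq 0 z D.b + d * D.uq 1 z D.b]) : BoundarySpace) ∈ S) : c = 0 ∧ d = 0 := by
  have h0 := eq_zero_of_mem_graph hS (mem_restrictBC_graph.2 ⟨_, _, uH_combination hz c d, by
    simpa [boundaryValues, u_spec hz] using h⟩)
  have := Fintype.linearIndependent_iff.1 (linearIndependent_uH hz) ![c, d] (by simpa using h0)
  exact ⟨this 0, this 1⟩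

/-! ### The coupled condition as a linear system. -/

theorem mem_coupledBC {F : Matrix.SpecialLinearGroup (Fin 2) ℝ} {φ : ℝ} {x₀ x₁ y₀ y₁ : ℂ} :
    ((![x₀, x₁], ![y₀, y₁]) : BoundarySpace) ∈ coupledBC F φ ↔
      y₀ = phase φ * ((F 0 0 : ℝ) * x₀ + (F 0 1 : ℝ) * x₁) ∧
      y₁ = phase φ * ((F 1 0 : ℝ) * x₀ + (F 1 1 : ℝ) * x₁) := by
  change ![y₀, y₁] = phase φ • (F.1.map Complex.ofReal).mulVec ![x₀, x₁] ↔ _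
  rw [funext_iff, Fin.forall_fin_two]
  simp

theorem phase_mul_phase_neg (φ : ℝ) : phase φ * phase (-φ) = 1 := by
  rw [phase, phase, ← Complex.exp_add]
  simp

theorem star_phase (φ : ℝ) : star (phase φ) = phase (-φ) := by
  rw [phase, phase, ← starRingEnd_apply, ← Complex.exp_conj]
  simp

theorem det_coe (F : Matrix.SpecialLinearGroup (Fin 2) ℝ) :
    ((F 0 0 : ℝ) : ℂ) * (F 1 1 : ℝ) - (F 0 1 : ℝ) * (F 1 0 : ℝ) = 1 := by
  have := F.2
  rw [Matrix.det_fin_two] at this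
  exact_mod_cast this

/-- As F₁₂ ≠ 0, the coupled condition can be solved for the quasi-derivatives: det F = 1 gives F₁₂
g^{[1]}(a) = e^{-iφ} g(b) - F₁₁ g(a) and F₁₂ g^{[1]}(b) = F₂₂ g(b) - e^{iφ} g(a). Here `s` and `t`
stand for the contribution of the Dirichlet part. -/
theorem Q_mulVec {F : Matrix.SpecialLinearGroup (Fin 2) ℝ} (hF : F 0 1 ≠ 0) {φ : ℝ} {z c d s t : ℂ} :
    ((![d, s + (c * D.uq 0 z D.a + d * D.uq 1 z D.a)],
      ![c, t + (c * D.uq 0 z D.b + d * D.uq 1 z D.b)]) : BoundarySpace) ∈ coupledBC F φ ↔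
      (D.Q F φ z).mulVec ![c, d] = ![t, -s] := by
  have h1 := phase_mul_phase_neg φ
  have hp : phase φ ≠ 0 := left_ne_zero_of_mul_eq_one h1
  have hn : phase (-φ) = (phase φ)⁻¹ := eq_inv_of_mul_eq_one_right h1
  have hF' : ((F 0 1 : ℝ) : ℂ) ≠ 0 := by exact_mod_cast hF
  have hdet := det_coe F
  rw [mem_coupledBC, funext_iff, Fin.forall_fin_two]
  simp only [Q, Matrix.mulVec, dotProduct, Fin.sum_univ_two, Matrix.of_apply, Matrix.cons_val_zero,
    Matrix.cons_val_one, hn]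
  generalize ((F 0 0 : ℝ) : ℂ) = A at *
  generalize ((F 0 1 : ℝ) : ℂ) = B at *
  generalize ((F 1 0 : ℝ) : ℂ) = C at *
  generalize ((F 1 1 : ℝ) : ℂ) = E at *
  generalize phase φ = P at *
  generalize D.uq 0 z D.a = a0
  generalize D.uq 0 z D.b = b0
  generalize D.uq 1 z D.a = a1
  generalize D.uq 1 z D.b = b1
  field_simp
  constructor
  · rintro ⟨e1, e2⟩
    constructor
    · linear_combination B * (-e2) + E * e1 + P * d * hdet
    · linear_combination -e1
  · rintro ⟨e1, e2⟩
    have e3 : c = P * (A * d + B * (s + (c * a0 + d * a1))) := by linear_combination -e2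
    refine ⟨e3, mul_left_cancel₀ hF' ?_⟩
    linear_combination -e1 + E * e3 + P * d * hdet

theorem coupledBC_inf_dirichletBC {F : Matrix.SpecialLinearGroup (Fin 2) ℝ} (hF : F 0 1 ≠ 0)
    (φ : ℝ) : coupledBC F φ ⊓ dirichletBC = ⊥ := by
  rw [eq_bot_iff]
  rintro ⟨x, y⟩ ⟨h, hx, hy⟩
  have hp : phase φ ≠ 0 := left_ne_zero_of_mul_eq_one (phase_mul_phase_neg φ)
  have hF' : ((F 0 1 : ℝ) : ℂ) ≠ 0 := by exact_mod_cast hF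
  have ex : x = ![x 0, x 1] := List.ofFn_inj.1 rfl
  have ey : y = ![y 0, y 1] := List.ofFn_inj.1 rfl
  rw [ex, ey] at h
  obtain ⟨h0, h1⟩ := mem_coupledBC.1 h
  replace hx : x 0 = 0 := hx
  replace hy : y 0 = 0 := hy
  rw [hx, hy] at h0
  have hx1 : x 1 = 0 := by simpa [hp, hF'] using h0.symm
  rw [hx, hx1] at h1
  rw [Submodule.mem_bot, ex, ey, hx, hx1, hy, h1]
  simp

theorem coupledBC_inf_dirichletBC_of_eq_zero {F : Matrix.SpecialLinearGroup (Fin 2) ℝ}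
    (hF : F 0 1 = 0) (φ : ℝ) : coupledBC F φ ⊓ dirichletBC = commonBC F φ := by
  ext ⟨x, y⟩
  have ex : x = ![x 0, x 1] := List.ofFn_inj.1 rfl
  have ey : y = ![y 0, y 1] := List.ofFn_inj.1 rfl
  rw [Submodule.mem_inf, ex, ey, mem_coupledBC]
  change _ ∧ (x 0 = 0 ∧ y 0 = 0) ↔ (x 0 = 0 ∧ y 0 = 0 ∧ y 1 = phase φ * (F 1 1 : ℝ) * x 1)
  constructor
  · rintro ⟨⟨-, h1⟩, hx, hy⟩
    exact ⟨hx, hy, by rw [h1, hx]; ring⟩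
  · rintro ⟨hx, hy, h1⟩
    exact ⟨⟨by simp [hx, hy, hF], by rw [h1, hx]; ring⟩, hx, hy⟩

/-! ### Krein's resolvent formulas. -/

/-- Krein's formula in the case `F₁₂ ≠ 0`. -/
theorem krein_of_ne_zero {F : Matrix.SpecialLinearGroup (Fin 2) ℝ} (hF : F 0 1 ≠ 0) {φ : ℝ} {z : ℂ}
    (hS : z ∈ resolventSet (D.Hcoupled F φ)) (hz : z ∈ resolventSet D.Hdir) :
    IsUnit (D.Q F φ z) ∧ ∀ f : D.H, resolvent (D.Hcoupled F φ) z f =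
      resolvent D.Hdir z f
        - ∑ j, ∑ k, ((D.Q F φ z)⁻¹ j k *
            inner ℂ (D.uH k (starRingEnd ℂ z)) f) • D.uH j z := by
  have hQ : IsUnit (D.Q F φ z) := by
    rw [← Matrix.mulVec_injective_iff_isUnit]
    refine (injective_iff_map_eq_zero (D.Q F φ z).mulVecLin).2 fun w hw => ?_
    have ew : w = ![w 0, w 1] := List.ofFn_inj.1 rfl
    rw [ew] at hw ⊢
    -- With `s = t = 0` a null vector of Q gives a kernel element satisfying the coupled condition.
    have := (Q_mulVec (D := D) hF (φ := φ) (z := z) (c := w 0) (d := w 1) (s := 0) (t := 0)).2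
      (by rw [← Matrix.mulVecLin_apply, hw]; ext i; fin_cases i <;> simp)
    simp only [zero_add] at this
    obtain ⟨h0, h1⟩ := eq_zero_of_boundaryValues_mem hS hz this
    simp [h0, h1]
  refine ⟨hQ, fun f => ?_⟩
  obtain ⟨c, d, hR, hm⟩ := resolvent_restrictBC hS hz f
  have hv := (Q_mulVec hF).1 hm
  have hdet := (Matrix.isUnit_iff_isUnit_det _).1 hQ
  have hcd : ![c, d] = (D.Q F φ z)⁻¹.mulVec
      ![-inner ℂ (D.uH 0 (star z)) f, -inner ℂ (D.uH 1 (star z)) f] := by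
    rw [← hv, Matrix.mulVec_mulVec, Matrix.nonsing_inv_mul _ hdet, Matrix.one_mulVec]
  have hc := congrFun hcd 0
  have hd := congrFun hcd 1
  simp only [Matrix.mulVec, dotProduct, Fin.sum_univ_two, Matrix.cons_val_zero,
    Matrix.cons_val_one] at hc hd
  refine hR.trans ?_
  rw [hc, hd]
  simp only [Fin.sum_univ_two, starRingEnd_apply]
  module

/-- Now det F = 1 reads F₁₁F₂₂ = 1, so the first coupled equation is equivalent to d = e^{-iφ}F₂₂ c;
substituting this into the second leaves one scalar equation for c. -/
theorem qScalar_mul {F : Matrix.SpecialLinearGroup (Fin 2) ℝ} (hF : F 0 1 = 0) {φ : ℝ} {z c d s t : ℂ} :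
    ((![d, s + (c * D.uq 0 z D.a + d * D.uq 1 z D.a)],
      ![c, t + (c * D.uq 0 z D.b + d * D.uq 1 z D.b)]) : BoundarySpace) ∈ coupledBC F φ ↔
      d = phase (-φ) * (F 1 1 : ℝ) * c ∧
        D.qScalar F φ z * c = t - phase φ * (F 1 1 : ℝ) * s := by
  have h1 := phase_mul_phase_neg φ
  have hdet := det_coe F
  rw [hF, Complex.ofReal_zero, zero_mul, sub_zero] at hdet
  rw [mem_coupledBC, qScalar, hF, Complex.ofReal_zero, zero_mul, add_zero]
  generalize ((F 0 0 : ℝ) : ℂ) = A at *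
  generalize ((F 1 0 : ℝ) : ℂ) = C at *
  generalize ((F 1 1 : ℝ) : ℂ) = E at *
  generalize phase φ = P at *
  generalize phase (-φ) = N at *
  generalize D.uq 0 z D.a = a0
  generalize D.uq 0 z D.b = b0
  generalize D.uq 1 z D.a = a1
  generalize D.uq 1 z D.b = b1
  have hd : c = P * (A * d) ↔ d = N * E * c := by
    constructor
    · intro h
      linear_combination (-N * E) * h - d * hdet - A * E * d * h1
    · intro h
      linear_combination (-P * A) * h - c * hdet - A * E * c * h1
  rw [hd]
  refine and_congr_right fun hd' => ?_
  subst hd'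
  constructor
  · intro h
    linear_combination -h - (C * E * c + E ^ 2 * a1 * c) * h1
  · intro h
    linear_combination -h - (C * E * c + E ^ 2 * a1 * c) * h1

/-- Krein's formula in the case `F₁₂ = 0`. -/
theorem krein_of_eq_zero {F : Matrix.SpecialLinearGroup (Fin 2) ℝ} (hF : F 0 1 = 0) {φ : ℝ} {z : ℂ}
    (hS : z ∈ resolventSet (D.Hcoupled F φ)) (hz : z ∈ resolventSet D.Hdir) :
    D.qScalar F φ z ≠ 0 ∧ ∀ f : D.H, resolvent (D.Hcoupled F φ) z f =
      resolvent D.Hdir z f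
        - ((D.qScalar F φ z)⁻¹ *
            inner ℂ (D.uF F φ (starRingEnd ℂ z)) f) • D.uF F φ z := by
  have hq : D.qScalar F φ z ≠ 0 := fun h0 => by
    have := (qScalar_mul (D := D) hF (φ := φ) (z := z) (c := 1) (s := 0) (t := 0)).2
      ⟨rfl, by simp [h0]⟩
    simp only [zero_add] at this
    exact one_ne_zero (eq_zero_of_boundaryValues_mem hS hz this).1
  refine ⟨hq, fun f => ?_⟩
  obtain ⟨c, d, hR, hm⟩ := resolvent_restrictBC hS hz f
  obtain ⟨hd, hc⟩ := (qScalar_mul hF).1 hm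
  -- The inner product is antilinear in its first entry, so the phase e^{-iφ} in `uF` turns into the
  -- e^{iφ} of the scalar equation.
  have hi : inner ℂ (D.uF F φ (star z)) f = -(D.qScalar F φ z * c) := by
    rw [hc, uF, inner_add_left, inner_smul_left, map_mul, Complex.conj_ofReal, starRingEnd_apply,
      star_phase, neg_neg]
    ring
  have hc' : c = -((D.qScalar F φ z)⁻¹ * inner ℂ (D.uF F φ (star z)) f) := by
    rw [hi]; field_simp
  refine hR.trans ?_
  rw [starRingEnd_apply, sub_eq_add_neg, ← neg_smul, ← hc', hd, uF]
  module

end SturmLiouville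

open SturmLiouville in
theorem theoremt3p2 (D : SturmLiouville) (F : Matrix.SpecialLinearGroup (Fin 2) ℝ) (φ : ℝ)
    (hφ : φ ∈ Set.Ico 0 (2 * Real.pi)) :
    -- the functions `u_j(z, ·)` are well defined (exist and are unique) and form a basis of `ker (H_max - z)`
    (∀ z ∈ SturmLiouville.resolventSet D.Hdir,
      (∀ j, D.IsSolution z (D.u j z) (D.uq j z)) ∧
      D.u 0 z D.a = 0 ∧ D.u 0 z D.b = 1 ∧ D.u 1 z D.a = 1 ∧ D.u 1 z D.b = 0 ∧
      (∀ j y v, D.IsSolution z y v → y D.a = D.u j z D.a → y D.b = D.u j z D.b →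
        Set.EqOn y (D.u j z) (Set.Icc D.a D.b) ∧ Set.EqOn v (D.uq j z) (Set.Icc D.a D.b)) ∧
      (∀ j, D.uH j z =ᵐ[D.μ] D.u j z) ∧
      LinearIndependent ℂ (fun j => D.uH j z) ∧
      Submodule.span ℂ (Set.range fun j => D.uH j z) = SturmLiouville.kernelAt D.Hmax z) ∧
    -- the case `F₁₂ ≠ 0`
    (F 0 1 ≠ 0 →
      SturmLiouville.maximalCommonPart (D.Hcoupled F φ) D.Hdir = D.Hmin ∧
      ∀ z ∈ SturmLiouville.resolventSet (D.Hcoupled F φ) ∩ SturmLiouville.resolventSet D.Hdir,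
        IsUnit (D.Q F φ z) ∧
        ∀ f : D.H, SturmLiouville.resolvent (D.Hcoupled F φ) z f =
          SturmLiouville.resolvent D.Hdir z f
            - ∑ j, ∑ k, ((D.Q F φ z)⁻¹ j k *
                inner ℂ (D.uH k (starRingEnd ℂ z)) f) • D.uH j z) ∧
    -- the case `F₁₂ = 0`
    (F 0 1 = 0 →
      SturmLiouville.maximalCommonPart (D.Hcoupled F φ) D.Hdir =
        D.restrictBC (SturmLiouville.commonBC F φ) ∧
      ∀ z ∈ SturmLiouville.resolventSet (D.Hcoupled F φ) ∩ SturmLiouville.resolventSet D.Hdir,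
        D.qScalar F φ z ≠ 0 ∧
        ∀ f : D.H, SturmLiouville.resolvent (D.Hcoupled F φ) z f =
          SturmLiouville.resolvent D.Hdir z f
            - ((D.qScalar F φ z)⁻¹ *
                inner ℂ (D.uF F φ (starRingEnd ℂ z)) f) • D.uF F φ z) := by
  refine ⟨fun z hz => ⟨fun j => (u_spec hz j).1, (u_spec hz 0).2.1, (u_spec hz 0).2.2,
    (u_spec hz 1).2.1, (u_spec hz 1).2.2, fun j y v h ha hb => ?_,
    fun j => coeFn_toH (u_spec hz j).1.pair.memLp, linearIndependent_uH hz, span_uH hz⟩,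
    fun hF => ⟨?_, fun z hz => krein_of_ne_zero hF hz.1 hz.2⟩,
    fun hF => ⟨?_, fun z hz => krein_of_eq_zero hF hz.1 hz.2⟩⟩
  · obtain ⟨h1, h2⟩ := h.expand hz
    obtain ⟨h3, h4⟩ := (u_spec hz j).1.expand hz
    rw [← ha, ← hb] at h3 h4
    exact ⟨h1.trans h3.symm, h2.trans h4.symm⟩
  · rw [Hcoupled, Hdir, maximalCommonPart_restrictBC, coupledBC_inf_dirichletBC hF, Hmin]
  · rw [Hcoupled, Hdir, maximalCommonPart_restrictBC, coupledBC_inf_dirichletBC_of_eq_zero hF]
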